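/- Let $\tau$ be the morphism $a\mapsto ab$, $b\mapsto ac$, $c\mapsto a$, and let $\mathbb{T}=\lim_{m\to\infty}\tau^m(a)$ be the Tribonacci word, its positions being numbered $1,2,3,\dots$. Put $T_m=\tau^m(a)$ for $m\ge 0$, and let $\delta_m$ be the last letter of $T_m$. Put $k_0=0$, $k_1=k_2=1$ and $k_m=k_{m-1}+k_{m-2}+k_{m-3}-1$ for $m\ge3$. The kernel words are $K_1=a$, $K_2=b$, $K_3=c$ and, for $m\ge4$, $K_m=\delta_{m-1}\,T_{m-3}[1,k_m-1]$, where $T_{m-3}[1,j]$ denotes the prefix of $T_{m-3}$ of length $j$. For a nonempty factor $\omega$ of $\mathbb{T}$, let $\mathrm{Ker}(\omega)$ be the kernel word of maximal order $m\geq 1$ that occurs in $\omega$, and for $p\ge1$ let $P(\omega,p)$ be the position in $\mathbb{T}$ of the last letter of the $p$-th occurrence of $\omega$ in $\mathbb{T}$ (occurrences may overlap and are ordered from left to right). For $m,p\ge1$ put $$\langle K_m,p\rangle=\{P(\omega,p):\ \omega \text{ is a nonempty palindrome occurring in } \mathbb{T},\ \mathrm{Ker}(\omega)=K_m\}.$$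 Then, for all $m\ge4$ and $p\ge1$, $$\langle K_m,p\rangle=\langle K_{m-3},P(c,p)+1\rangle\cup\langle K_{m-2},P(b,p)+1\rangle\cup\langle K_{m-1},P(a,p)+1\rangle,$$ and the three sets on the right-hand side are pairwise disjoint. -/

import Mathlib

namespace Tribonacci

/-- The alphabet `{a, b, c}`. -/
inductive Letter
  | a
  | b
  | c
  deriving DecidableEq

/-- The morphism `τ(a, b, c) = (ab, ac, a)` on letters. -/
def tauLetter : Letter → List Letter
  | .a => [.a, .b]
  | .b => [.a, .c]
  | .c => [.a]

/-- The morphism `τ` on finite words. -/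
def tau (w : List Letter) : List Letter := w.flatMap tauLetter

/-- `T m = τ^m(a)`. -/
def T (m : ℕ) : List Letter := tau^[m] [Letter.a]

theorem T_succ (m : ℕ) : T (m + 1) = tau (T m) :=
  Function.iterate_succ_apply' tau m [Letter.a]

theorem length_le_length_tau (w : List Letter) : w.length ≤ (tau w).length := by
  induction w with
  | nil => simp [tau]
  | cons x w ih =>
    have h : 1 ≤ (tauLetter x).length := by cases x <;> simp [tauLetter]
    simp only [tau, List.flatMap_cons, List.length_append, List.length_cons] at ih ⊢
    omega

theorem exists_T_eq_cons (m : ℕ) : ∃ w, T m = Letter.a :: w ∧ m ≤ w.length := by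
  induction m with
  | zero => exact ⟨[], rfl, le_rfl⟩
  | succ m ih =>
    obtain ⟨w, hw, hl⟩ := ih
    refine ⟨Letter.b :: tau w, ?_, ?_⟩
    · rw [T_succ, hw]; rfl
    · have := length_le_length_tau w
      simp only [List.length_cons]
      omega

theorem lt_length_T (m : ℕ) : m < (T m).length := by
  obtain ⟨w, hw, hl⟩ := exists_T_eq_cons m
  rw [hw, List.length_cons]
  omega

/-- The Tribonacci word, with positions counted from `0`: its `n`-th letter is the `n`-th letter
of `τ^n(a)`. Since `τ^m(a)` is a prefix of `τ^(m+1)(a)` for all `m` (see `T_prefix_T_succ` and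
`T_eq_map_word`), this is the fixed point of `τ` beginning with `a`. -/
def word (n : ℕ) : Letter := (T n)[n]'(lt_length_T n)

theorem T_prefix_T_succ (m : ℕ) : T m <+: T (m + 1) := by
  induction m with
  | zero => exact ⟨[Letter.b], rfl⟩
  | succ m ih =>
    obtain ⟨u, hu⟩ := ih
    refine ⟨tau u, ?_⟩
    rw [T_succ (m + 1), T_succ m]
    conv_rhs => rw [← T_succ m, ← hu]
    simp [tau]

theorem T_prefix_T {m n : ℕ} (h : m ≤ n) : T m <+: T n := by
  induction h with
  | refl => exact List.prefix_refl _
  | step _ ih => exact ih.trans (T_prefix_T_succ _)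

/-- Every `τ^m(a)` is a prefix of the Tribonacci word. -/
theorem T_eq_map_word (m : ℕ) : T m = (List.range (T m).length).map word := by
  refine List.ext_getElem (by simp) fun i h₁ h₂ => ?_
  simp only [List.getElem_map, List.getElem_range, word]
  rcases le_total m i with h | h
  · exact (T_prefix_T h).getElem h₁
  · exact ((T_prefix_T h).getElem (lt_length_T i)).symm

/-- The factor `𝕋[L, L + n - 1]` of length `n` starting at position `L`, where the positions in
the Tribonacci word `𝕋` are counted from `1` (so that `L ≥ 1`). -/
def factorAt (L n : ℕ) : List Letter := (List.range n).map fun k => word (L - 1 + k)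

/-- The word `w` occurs in the Tribonacci word with its first letter at position `L`
(positions are counted from `1`). -/
def OccursAt (w : List Letter) (L : ℕ) : Prop := 1 ≤ L ∧ w = factorAt L w.length

/-- `L(w, p)`: the position of the first letter of the `p`-th occurrence of `w`, for `p ≥ 1`. -/
noncomputable def firstPos (w : List Letter) (p : ℕ) : ℕ := Nat.nth (OccursAt w) (p - 1)

/-- `P(w, p) = L(w, p) + |w| - 1`: the position of the last letter of the `p`-th occurrence
of `w`, for `p ≥ 1`. -/
noncomputable def lastPos (w : List Letter) (p : ℕ) : ℕ := firstPos w p + w.length - 1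

/-- The set of all palindromes occurring in the Tribonacci word. -/
def palindromes : Set (List Letter) := {w | w.reverse = w ∧ ∃ L, OccursAt w L}

/-- The last letter `δ_m` of `T m` (the word `T m` is never empty). -/
def delta (m : ℕ) : Letter :=
  (T m).getLast (List.ne_nil_of_length_pos (Nat.zero_lt_of_lt (lt_length_T m)))

/-- The kernel numbers: `k₀ = 0`, `k₁ = k₂ = 1`, `k_m = k_{m-1} + k_{m-2} + k_{m-3} - 1`
for `m ≥ 3`. -/
def kernelNumber : ℕ → ℕ
  | 0 => 0
  | 1 => 1
  | 2 => 1
  | m + 3 => kernelNumber (m + 2) + kernelNumber (m + 1) + kernelNumber m - 1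

/-- The kernel words `K₁ = a`, `K₂ = b`, `K₃ = c` and `K_m = δ_{m-1} T_{m-3}[1, k_m - 1]` for
`m ≥ 4`. (The index `0` is not used.) -/
def kernelWord : ℕ → List Letter
  | 0 => []
  | 1 => [Letter.a]
  | 2 => [Letter.b]
  | 3 => [Letter.c]
  | m + 4 => delta (m + 3) :: (T (m + 1)).take (kernelNumber (m + 4) - 1)

/-- `Ker(w) = K_m`: the kernel word `K_m`, `m ≥ 1`, is the one of maximal order among the kernel
words that occur in `w`. (No kernel word occurs in the empty word, which thus has no kernel.) -/
def HasKernel (w : List Letter) (m : ℕ) : Prop :=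
  IsGreatest {j | 1 ≤ j ∧ kernelWord j <:+: w} m

/-- `⟨K_m, p⟩ = {P(w, p) : w a palindrome occurring in the Tribonacci word, Ker(w) = K_m}`. -/
def bracket (m p : ℕ) : Set ℕ := {n | ∃ w ∈ palindromes, HasKernel w m ∧ lastPos w p = n}

end Tribonacci

namespace Tribonacci

/-! Let `sig n` be the length of the image under τ of the first n letters of 𝕋. The map w ↦ τ(w)a
sends palindromes of 𝕋 to those that begin with a. Every nonempty palindrome is such an image, or
such an image stripped of its outer letters a, the latter with w not beginning with c. Since an
occurrence of τ(w)a is the image of an occurrence of w (`occ_tau`), positions transform by `sig`.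
Kernel words obey the same rule: K_{m+2} is τ(K_{m+1})a, stripped unless K_{m+1} begins with c.
Hence both operations raise the order of the kernel by one.

By induction (`palSpec`), the palindromes with kernel K_{m+1} are concentric: they arise from the
prefix of length `cen (m + 1)` by deleting x letters at each end, 0 ≤ x < `len m`. The one with
parameter x occurs exactly at the positions sig^{m+1}(n) + x, counted from 0. As `cen (m + 1) = len
m + cen m`, each ⟨K_{m+1}, p⟩ is the interval of integers from S + cen m (excluded) to S + cen
(m+1), where S = sig^{m+1}(p-1) (`bracket_eq_Ioc`).

For ⟨K_{k+4}, p⟩, the three sets on the right all have the same base point B = sig^{k+4}(p-1) + len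
(k+3), by additivity of `sig` along recurring prefixes (`iterate_sig_add_len`). They are therefore
consecutive intervals cut at B + cen k, ..., B + cen (k+3), and the Tribonacci recurrence for `len`
identifies their union with the left side. -/

/-- The cyclic successor `a ↦ b ↦ c ↦ a` on letters. -/
def Letter.next : Letter → Letter
  | .a => .b
  | .b => .c
  | .c => .a

@[simp] theorem tau_nil : tau [] = [] := rfl

theorem tau_append (u v : List Letter) : tau (u ++ v) = tau u ++ tau v := by
  simp [tau]

theorem tau_cons (l : Letter) (v : List Letter) : tau (l :: v) = tauLetter l ++ tau v := by
  simp [tau]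

theorem tau_singleton (l : Letter) : tau [l] = tauLetter l := by
  simp [tau]

/-! ### Factors and occurrences, with positions counted from 0 -/

/-- The factor of length `n` of the Tribonacci word beginning at the position `x`, where positions
are counted from `0`. -/
def seg (x n : ℕ) : List Letter := (List.range n).map fun k => word (x + k)

@[simp] theorem seg_length (x n : ℕ) : (seg x n).length = n := by simp [seg]

@[simp] theorem seg_zero (x : ℕ) : seg x 0 = [] := rfl

theorem seg_one (x : ℕ) : seg x 1 = [word x] := by simp [seg]

theorem seg_add (x m n : ℕ) : seg x (m + n) = seg x m ++ seg (x + m) n := by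
  simp [seg, List.range_add, Nat.add_assoc, Function.comp_def]

theorem seg_succ (x n : ℕ) : seg x (n + 1) = seg x n ++ [word (x + n)] := by
  rw [seg_add, seg_one]

theorem seg_cons (x n : ℕ) : seg x (n + 1) = word x :: seg (x + 1) n := by
  rw [Nat.add_comm, seg_add, seg_one]; rfl

/-- The word `w` occurs in the Tribonacci word at the position `z`, counted from `0`. -/
def Occ (w : List Letter) (z : ℕ) : Prop := w = seg z w.length

theorem occ_seg (x n : ℕ) : Occ (seg x n) x := by simp [Occ]

@[simp] theorem occ_nil (z : ℕ) : Occ [] z := rfl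

theorem occ_append {u v : List Letter} {z : ℕ} :
    Occ (u ++ v) z ↔ Occ u z ∧ Occ v (z + u.length) := by
  rw [Occ, List.length_append, seg_add]
  exact ⟨fun h => List.append_inj h (by simp), fun h => congrArg₂ (· ++ ·) h.1 h.2⟩

theorem occ_singleton {l : Letter} {z : ℕ} : Occ [l] z ↔ word z = l := by
  simp [Occ, seg_one, eq_comm]

theorem occ_cons {l : Letter} {w : List Letter} {z : ℕ} :
    Occ (l :: w) z ↔ word z = l ∧ Occ w (z + 1) := by
  rw [← List.singleton_append, occ_append, occ_singleton]; rfl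

theorem occursAt_iff {w : List Letter} {L : ℕ} : OccursAt w L ↔ ∃ z, Occ w z ∧ L = z + 1 := by
  constructor
  · rintro ⟨h1, h2⟩
    exact ⟨L - 1, h2, by omega⟩
  · rintro ⟨z, h, rfl⟩
    exact ⟨by omega, h⟩

theorem infix_seg_iff {v : List Letter} {x n : ℕ} :
    v <:+: seg x n ↔ ∃ z, x ≤ z ∧ z + v.length ≤ x + n ∧ Occ v z := by
  constructor
  · rintro ⟨s, t, h⟩
    have ho : Occ (s ++ v ++ t) x := h ▸ occ_seg x n
    have hl := congrArg List.length h
    simp only [List.length_append, seg_length] at hl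
    exact ⟨x + s.length, by omega, by omega, (occ_append.1 (occ_append.1 ho).1).2⟩
  · rintro ⟨z, h1, h2, h3⟩
    refine ⟨seg x (z - x), seg (z + v.length) (x + n - (z + v.length)), ?_⟩
    rw [h3, seg_length]
    obtain ⟨d, rfl⟩ := Nat.exists_eq_add_of_le h1
    obtain ⟨e, he⟩ := Nat.exists_eq_add_of_le h2
    obtain rfl : n = d + v.length + e := by omega
    have e1 : x + d - x = d := by omega
    have e2 : x + (d + v.length + e) - (x + d + v.length) = e := by omega
    rw [e1, e2, seg_add x (d + v.length), seg_add x d, ← Nat.add_assoc]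

theorem T_eq_seg (m : ℕ) : T m = seg 0 (T m).length := by
  simpa [seg] using T_eq_map_word m

/-! ### The position map of τ and synchronisation -/

/-- The position at which the image of the `n`-th letter begins in `𝕋 = τ(𝕋)`. -/
def sig (n : ℕ) : ℕ := (tau (seg 0 n)).length

theorem tau_seg_zero (n : ℕ) : tau (seg 0 n) = seg 0 (sig n) := by
  obtain ⟨r, hr⟩ := Nat.exists_eq_add_of_lt (lt_length_T n)
  have h := T_eq_seg (n + 1)
  rw [T_succ n] at h
  nth_rewrite 1 [T_eq_seg n] at h
  rw [hr, Nat.add_assoc, seg_add, tau_append] at h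
  have h2 : Occ (tau (seg 0 n) ++ tau (seg (0 + n) (r + 1))) 0 := by
    rw [h]; exact occ_seg _ _
  exact (occ_append.1 h2).1

theorem sig_add (x n : ℕ) : sig (x + n) = sig x + (tau (seg x n)).length := by
  simp [sig, seg_add, tau_append]

theorem occ_tau_seg (x n : ℕ) : Occ (tau (seg x n)) (sig x) := by
  have h := occ_seg 0 (sig (x + n))
  rw [← tau_seg_zero, seg_add, tau_append, occ_append, Nat.zero_add, Nat.zero_add] at h
  exact h.2

theorem tau_seg (x n : ℕ) : tau (seg x n) = seg (sig x) (sig (x + n) - sig x) := by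
  rw [sig_add, Nat.add_sub_cancel_left]
  exact occ_tau_seg x n

theorem occ_tauLetter (n : ℕ) : Occ (tauLetter (word n)) (sig n) := by
  have h := occ_tau_seg n 1
  rwa [seg_one, tau_singleton] at h

theorem sig_succ (n : ℕ) : sig (n + 1) = sig n + (tauLetter (word n)).length := by
  rw [sig_add, seg_one, tau_singleton]

theorem sig_succ_of_ne {n : ℕ} (h : word n ≠ .c) : sig (n + 1) = sig n + 2 := by
  rw [sig_succ]; cases hw : word n <;> simp_all [tauLetter]

theorem sig_succ_of_eq {n : ℕ} (h : word n = .c) : sig (n + 1) = sig n + 1 := by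
  rw [sig_succ, h]; rfl

theorem sig_strictMono : StrictMono sig := by
  refine strictMono_nat_of_lt_succ fun n => ?_
  rw [sig_succ]
  cases word n <;> simp [tauLetter]

@[simp] theorem sig_zero : sig 0 = 0 := rfl

theorem word_sig (n : ℕ) : word (sig n) = .a := by
  have h := occ_tauLetter n
  cases hw : word n <;> rw [hw] at h <;> exact (occ_cons.1 h).1

theorem word_sig_succ (n : ℕ) : word (sig n + 1) = (word n).next := by
  by_cases hc : word n = .c
  · rw [← sig_succ_of_eq hc, word_sig, hc]; rfl
  · have h := occ_tauLetter n
    cases hw : word n <;> rw [hw] at h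
    · exact (occ_cons.1 (occ_cons.1 h).2).1
    · exact (occ_cons.1 (occ_cons.1 h).2).1
    · exact absurd hw hc

theorem exists_sig (y : ℕ) : ∃ n, y = sig n ∨ (y = sig n + 1 ∧ word n ≠ .c) := by
  induction y with
  | zero => exact ⟨0, Or.inl rfl⟩
  | succ y ih =>
    obtain ⟨n, rfl | ⟨rfl, h⟩⟩ := ih
    · by_cases hc : word n = .c
      · exact ⟨n + 1, Or.inl (sig_succ_of_eq hc).symm⟩
      · exact ⟨n, Or.inr ⟨rfl, hc⟩⟩
    · exact ⟨n + 1, Or.inl (sig_succ_of_ne h).symm⟩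

theorem word_sig_succ_ne {n : ℕ} (h : word n ≠ .c) : word (sig n + 1) ≠ .a := by
  rw [word_sig_succ]; cases hw : word n <;> simp_all [Letter.next]

theorem word_eq_a_iff {y : ℕ} : word y = .a ↔ ∃ n, y = sig n := by
  constructor
  · intro h
    obtain ⟨n, hn | ⟨rfl, hn⟩⟩ := exists_sig y
    · exact ⟨n, hn⟩
    · exact absurd h (word_sig_succ_ne hn)
  · rintro ⟨n, rfl⟩
    exact word_sig n

/-- Letters other than `a` are surrounded by letters `a`. -/
theorem word_ne_a {y : ℕ} (h : word y ≠ .a) :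
    ∃ z, y = z + 1 ∧ word z = .a ∧ word (y + 1) = .a := by
  obtain ⟨n, rfl | ⟨rfl, hn⟩⟩ := exists_sig y
  · exact absurd (word_sig n) h
  · refine ⟨sig n, rfl, word_sig n, ?_⟩
    have := sig_succ_of_ne hn
    rw [Nat.add_assoc, ← this]
    exact word_sig _

/-- The letter a starts every image and occurs nowhere else in one, so it marks the cuts between
images; the final a closes the last image, which would otherwise be ambiguous when w ends in c. -/
theorem occ_tau_sig {w : List Letter} {z : ℕ} : Occ (tau w ++ [.a]) (sig z) ↔ Occ w z := by
  induction w generalizing z with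
  | nil => simp [occ_singleton, word_sig]
  | cons l w ih =>
    have hs := word_sig z
    have hs' := word_sig_succ z
    rw [occ_cons, ← ih, tau_cons]
    -- Excludes a c in w facing an a or b of 𝕋: the image of the latter has a second letter other
    -- than a.
    have hh : ∀ y, Occ (tau w ++ [.a]) y → word y = .a := by
      intro y h
      cases w with
      | nil => simpa [occ_singleton] using h
      | cons l w =>
        rw [tau_cons] at h
        cases l <;> exact (occ_cons.1 h).1
    cases hz : word z <;> rw [hz] at hs' <;> cases l <;>
      simp only [tauLetter, List.cons_append, List.nil_append, occ_cons, hs, hs', Letter.next,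
        true_and, reduceCtorEq, false_and, iff_false]
    · rw [sig_succ_of_ne (by simp [hz])]
    · intro h; simpa [hs', Letter.next] using hh _ h
    · rw [sig_succ_of_ne (by simp [hz])]
    · intro h; simpa [hs', Letter.next] using hh _ h
    · rw [sig_succ_of_eq hz]

theorem occ_tau {w : List Letter} {y : ℕ} :
    Occ (tau w ++ [.a]) y ↔ ∃ z, y = sig z ∧ Occ w z := by
  constructor
  · intro h
    have ha : word y = .a := by
      cases w with
      | nil => simpa [occ_singleton] using h
      | cons l w =>
        rw [tau_cons] at h
        cases l <;> exact (occ_cons.1 h).1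
    obtain ⟨z, rfl⟩ := word_eq_a_iff.1 ha
    exact ⟨z, rfl, occ_tau_sig.1 h⟩
  · rintro ⟨z, rfl, h⟩
    exact occ_tau_sig.2 h

theorem sig_add_of_occ {w : List Letter} {z : ℕ} (h : Occ w z) :
    sig (z + w.length) = sig z + (tau w).length := by
  rw [sig_add, ← h]

/-- A word that begins and ends with letters other than `a` occurs together with a letter `a` on
either side. -/
theorem occ_surround {v : List Letter} {d e : Letter} (hd : v.head? = some d) (hda : d ≠ .a)
    (he : v.getLast? = some e) (hea : e ≠ .a) {y : ℕ} :
    Occ v y ↔ ∃ z, y = z + 1 ∧ Occ (.a :: v ++ [.a]) z := by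
  constructor
  · intro h
    obtain ⟨u, rfl⟩ : ∃ u, v = d :: u := by
      cases v <;> simp_all
    have h1 := (occ_cons.1 h).1
    obtain ⟨z, rfl, hz, -⟩ := word_ne_a (h1 ▸ hda)
    obtain ⟨s, hs⟩ : ∃ s, d :: u = s ++ [e] := List.getLast?_eq_some_iff.1 he
    refine ⟨z, rfl, ?_⟩
    rw [List.cons_append, occ_cons, occ_append, occ_singleton]
    refine ⟨hz, h, ?_⟩
    rw [hs] at h ⊢
    have h2 := occ_singleton.1 (occ_append.1 h).2
    obtain ⟨-, -, -, h3⟩ := word_ne_a (h2 ▸ hea)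
    simpa [Nat.add_assoc] using h3
  · rintro ⟨z, rfl, h⟩
    rw [List.cons_append, occ_cons, occ_append] at h
    exact h.2.1

theorem tau_append_a_cons (w : List Letter) : ∃ u, tau w ++ [.a] = Letter.a :: u := by
  cases w with
  | nil => exact ⟨[], rfl⟩
  | cons l w => rw [tau_cons]; cases l <;> exact ⟨_, rfl⟩

theorem tau_append_a_injective {u v : List Letter} (h : tau u ++ [.a] = tau v ++ [.a]) :
    u = v := by
  induction u generalizing v with
  | nil =>
    cases v with
    | nil => rfl
    | cons l v =>
      obtain ⟨r, hr⟩ := tau_append_a_cons v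
      rw [tau_cons, List.append_assoc, hr] at h
      cases l <;> simp [tauLetter] at h
  | cons k u ih =>
    obtain ⟨s, hs⟩ := tau_append_a_cons u
    cases v with
    | nil =>
      rw [tau_cons, List.append_assoc, hs] at h
      cases k <;> simp [tauLetter] at h
    | cons l v =>
      obtain ⟨r, hr⟩ := tau_append_a_cons v
      have ih' := @ih v
      rw [tau_cons, List.append_assoc, tau_cons, List.append_assoc] at h
      rw [hs, hr] at h ih'
      cases k <;> cases l <;> simp_all [tauLetter]

/-- For each letter l, τ(l)a is a palindrome, so reversal only reverses the order of the blocks. -/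
theorem reverse_tau_append_a (w : List Letter) :
    (tau w ++ [Letter.a]).reverse = tau w.reverse ++ [Letter.a] := by
  induction w with
  | nil => rfl
  | cons l w ih =>
    rw [tau_cons, List.append_assoc, List.reverse_append, ih, List.reverse_cons, tau_append,
      tau_singleton]
    cases l <;> simp [tauLetter]

theorem tau_append_a_palindrome {w : List Letter} :
    (tau w ++ [Letter.a]).reverse = tau w ++ [Letter.a] ↔ w.reverse = w := by
  rw [reverse_tau_append_a]
  exact ⟨tau_append_a_injective, fun h => by rw [h]⟩

/-! ### Additivity of the position map, and the lengths `len` and `cen` -/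

theorem seg_zero_seven : seg 0 7 = [.a, .b, .a, .c, .a, .b, .a] := (T_eq_seg 3).symm

theorem seg_zero_four : seg 0 4 = [.a, .b, .a, .c] := (T_eq_seg 2).symm

theorem seg_zero_two : seg 0 2 = [.a, .b] := (T_eq_seg 1).symm

theorem seg_zero_one : seg 0 1 = [.a] := (T_eq_seg 0).symm

theorem word_zero : word 0 = .a := rfl

theorem sig_one : sig 1 = 2 := by rw [sig, seg_zero_one]; rfl

theorem sig_two : sig 2 = 4 := by rw [sig, seg_zero_two]; rfl

theorem sig_four : sig 4 = 7 := by rw [sig, seg_zero_four]; rfl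

theorem seg_zero_sig (n : ℕ) : seg 0 (sig n + 1) = tau (seg 0 n) ++ [.a] := by
  rw [seg_succ, tau_seg_zero, Nat.zero_add, word_sig]

theorem Occ.seg_sig {n y : ℕ} (h : Occ (seg 0 n) y) : Occ (seg 0 (sig n + 1)) (sig y) := by
  rw [seg_zero_sig]
  exact occ_tau_sig.2 h

theorem Occ.seg_of_le {m n y : ℕ} (hmn : m ≤ n) (h : Occ (seg 0 n) y) : Occ (seg 0 m) y := by
  obtain ⟨d, rfl⟩ := Nat.exists_eq_add_of_le hmn
  rw [seg_add, occ_append] at h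
  exact h.1

theorem Occ.sig_add {n y : ℕ} (h : Occ (seg 0 n) y) : sig (y + n) = sig y + sig n := by
  have := sig_add_of_occ h
  rwa [seg_length] at this

theorem Occ.iterate_sig_add {n y : ℕ} (h : Occ (seg 0 n) y) (j : ℕ) :
    sig^[j] (y + n) = sig^[j] y + sig^[j] n := by
  induction j generalizing n y with
  | zero => rfl
  | succ j ih =>
    rw [Function.iterate_succ_apply, h.sig_add, ih (h.seg_sig.seg_of_le (Nat.le_succ _))]
    rfl

/-- The length of `T m`, see `length_T`. -/
def len (m : ℕ) : ℕ := sig^[m] 1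

theorem len_zero : len 0 = 1 := rfl

theorem len_succ (m : ℕ) : len (m + 1) = sig (len m) := Function.iterate_succ_apply' sig m 1

theorem len_one : len 1 = 2 := sig_one

theorem len_two : len 2 = 4 := by rw [len_succ, len_one, sig_two]

theorem len_pos (m : ℕ) : 0 < len m := by
  induction m with
  | zero => exact Nat.one_pos
  | succ m ih => rw [len_succ]; exact sig_strictMono ih

theorem length_T (m : ℕ) : (T m).length = len m := by
  induction m with
  | zero => rfl
  | succ m ih => rw [T_succ, T_eq_seg, ih, len_succ]; rfl

theorem T_eq_seg_len (m : ℕ) : T m = seg 0 (len m) := by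
  rw [← length_T]; exact T_eq_seg m

theorem iterate_sig_two (m : ℕ) : sig^[m] 2 = len (m + 1) := by
  rw [len, Function.iterate_succ_apply, sig_one]

theorem iterate_sig_four (m : ℕ) : sig^[m] 4 = len (m + 2) := by
  rw [len, Function.iterate_succ_apply, sig_one, Function.iterate_succ_apply, sig_two]

theorem iterate_sig_seven (m : ℕ) : sig^[m] 7 = len (m + 3) := by
  rw [len, Function.iterate_succ_apply, sig_one, Function.iterate_succ_apply, sig_two,
    Function.iterate_succ_apply, sig_four]

theorem len_add_three (m : ℕ) : len (m + 3) = len (m + 2) + len (m + 1) + len m := by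
  have h := occ_seg 0 7
  rw [seg_zero_seven] at h
  simp only [occ_cons, Nat.zero_add, Nat.reduceAdd] at h
  obtain ⟨h0, h1, h2, h3, h4, h5, h6, -⟩ := h
  have hs : seg 0 3 = [.a, .b, .a] := by
    simp only [seg_cons, seg_zero, Nat.zero_add, Nat.reduceAdd, h0, h1, h2]
  -- The splittings 7 = 4 + 3 and 3 = 2 + 1 occur where a prefix recurs, so iterates of `sig` are
  -- additive along them.
  have o1 : Occ (seg 0 3) 4 := by
    simp [hs, occ_cons, h4, h5, h6]
  have o2 : Occ (seg 0 1) 2 := by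
    simp [seg_one, word_zero, occ_singleton, h2]
  rw [← iterate_sig_seven, ← iterate_sig_four, ← iterate_sig_two, o1.iterate_sig_add m,
    o2.iterate_sig_add m, Nat.add_assoc]
  rfl

/-- The length of the prefix of the Tribonacci word which is the longest palindrome with the
kernel `K_m`. -/
def cen (m : ℕ) : ℕ := (fun n => sig n + 1)^[m] 0

theorem cen_zero : cen 0 = 0 := rfl

theorem cen_succ (m : ℕ) : cen (m + 1) = sig (cen m) + 1 :=
  Function.iterate_succ_apply' _ m 0

theorem cen_one : cen 1 = 1 := by rw [cen_succ, cen_zero, sig_zero]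

/-- This recurrence of a prefix makes `sig` additive at `len m + cen m`, which drives the induction
for `cen_succ_eq_len_add`. -/
theorem occ_seg_cen_len (m : ℕ) : Occ (seg 0 (cen m)) (len m) := by
  induction m with
  | zero => exact occ_nil _
  | succ m ih => rw [cen_succ, len_succ]; exact ih.seg_sig

theorem cen_succ_eq_len_add (m : ℕ) : cen (m + 1) = len m + cen m := by
  induction m with
  | zero => rw [cen_one, len_zero, cen_zero]
  | succ m ih =>
    rw [cen_succ (m + 1), ih, (occ_seg_cen_len m).sig_add, ← len_succ, ← ih, cen_succ m]
    omega

theorem cen_lt_len (m : ℕ) : cen m < len (m + 1) := by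
  induction m with
  | zero => exact len_pos 1
  | succ m ih =>
    have h1 := cen_succ_eq_len_add m
    have h2 : len m + len (m + 1) ≤ len (m + 1 + 1) := by
      cases m with
      | zero => rw [len_two, len_one, len_zero]; omega
      | succ m =>
        have : len (m + 1 + 1 + 1) = len (m + 1 + 1) + len (m + 1) + len m := len_add_three m
        omega
    omega

theorem cen_add_three (m : ℕ) : cen (m + 3) = cen (m + 2) + cen (m + 1) + cen m + 3 := by
  induction m with
  | zero => simp only [cen_succ_eq_len_add, Nat.zero_add, len_two, len_one, len_zero, cen_zero]
  | succ m ih =>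
    have h0 := cen_succ_eq_len_add m
    have h1 : cen (m + 2) = len (m + 1) + cen (m + 1) := cen_succ_eq_len_add (m + 1)
    have h2 : cen (m + 3) = len (m + 2) + cen (m + 2) := cen_succ_eq_len_add (m + 2)
    have h3 : cen (m + 4) = len (m + 3) + cen (m + 3) := cen_succ_eq_len_add (m + 3)
    have h4 := len_add_three m
    change cen (m + 4) = cen (m + 3) + cen (m + 2) + cen (m + 1) + 3
    omega

/-! ### Kernel words and their images -/

theorem kernelNumber_add_four (m : ℕ) : kernelNumber (m + 4) = cen m + 2 := by
  induction m using Nat.strong_induction_on with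
  | _ m ih =>
    have hk : kernelNumber (m + 4) =
      kernelNumber (m + 3) + kernelNumber (m + 2) + kernelNumber (m + 1) - 1 := rfl
    have c1 := cen_one
    have c2 : cen 2 = 3 := by rw [cen_succ, cen_one, sig_one]
    match m with
    | 0 => rfl
    | 1 => rw [cen_one]; rfl
    | 2 => rw [c2]; rfl
    | m + 3 =>
      have h0 := ih m (by omega)
      have h1 := ih (m + 1) (by omega)
      have h2 := ih (m + 2) (by omega)
      have := cen_add_three m
      have e1 : m + 3 + 3 = m + 2 + 4 := by omega
      have e2 : m + 3 + 2 = m + 1 + 4 := by omega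
      have e3 : m + 3 + 1 = m + 4 := by omega
      rw [e1, e2, e3] at hk
      omega

theorem word_cen (m : ℕ) : word (cen m) = Letter.next^[m] .a := by
  induction m with
  | zero => rfl
  | succ m ih => rw [cen_succ, word_sig_succ, ih, Function.iterate_succ_apply']

theorem getLast?_T (m : ℕ) : (T m).getLast? = some (Letter.next^[m] .a) := by
  induction m with
  | zero => rfl
  | succ m ih =>
    obtain ⟨u, hu⟩ := List.getLast?_eq_some_iff.1 ih
    rw [T_succ, hu, tau_append, tau_singleton, Function.iterate_succ_apply']
    cases Letter.next^[m] .a <;> simp [tauLetter, Letter.next]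

theorem next_iterate_three (l : Letter) : Letter.next^[3] l = l := by
  cases l <;> rfl

/-- Both letters run cyclically through a, b, c as m grows, and the shift by 3 is a full period. -/
theorem delta_add_three (m : ℕ) : delta (m + 3) = word (cen m) := by
  have h := getLast?_T (m + 3)
  rw [Function.iterate_add_apply, next_iterate_three, ← word_cen] at h
  exact Option.some_injective _ (by rw [← h, delta, List.getLast?_eq_some_getLast])

/-- Thus K_{m+4} is the prefix of length `cen m` enclosed between two copies of the letter that
follows it. -/
theorem kernelWord_add_four (m : ℕ) :
    kernelWord (m + 4) = word (cen m) :: seg 0 (cen m + 1) := by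
  have h : kernelWord (m + 4) =
    delta (m + 3) :: (T (m + 1)).take (kernelNumber (m + 4) - 1) := rfl
  obtain ⟨d, hd⟩ := Nat.exists_eq_add_of_lt (cen_lt_len m)
  rw [h, delta_add_three, kernelNumber_add_four, T_eq_seg_len, hd,
    show cen m + d + 1 = (cen m + 1) + d by omega, seg_add]
  simp

/-- The first and last letter of the kernel word `K_m`, for `m ≥ 1`. -/
theorem kernelWord_ends (m : ℕ) :
    (kernelWord (m + 1)).head? = some (Letter.next^[m] .a) ∧
      (kernelWord (m + 1)).getLast? = some (Letter.next^[m] .a) := by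
  match m with
  | 0 => exact ⟨rfl, rfl⟩
  | 1 => exact ⟨rfl, rfl⟩
  | 2 => exact ⟨rfl, rfl⟩
  | m + 3 =>
    rw [kernelWord_add_four, Function.iterate_add_apply, next_iterate_three, ← word_cen]
    refine ⟨rfl, ?_⟩
    rw [seg_succ, ← List.cons_append, Nat.zero_add]
    exact List.getLast?_concat

theorem tau_kernelWord_of_ne {m : ℕ} (h : Letter.next^[m] .a ≠ .c) :
    tau (kernelWord (m + 1)) ++ [.a] = .a :: kernelWord (m + 2) ++ [.a] := by
  match m with
  | 0 => rfl
  | 1 => rfl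
  | 2 => exact absurd rfl h
  | m + 3 =>
    rw [Function.iterate_add_apply, next_iterate_three, ← word_cen] at h
    rw [kernelWord_add_four, show m + 3 + 2 = m + 1 + 4 by omega, kernelWord_add_four, tau_cons,
      List.append_assoc, ← seg_zero_sig, sig_succ_of_ne h, cen_succ, word_sig_succ,
      seg_succ _ (sig (cen m) + 2), ← sig_succ_of_ne h, Nat.zero_add, word_sig, sig_succ_of_ne h]
    cases hw : word (cen m)
    · rfl
    · rfl
    · exact absurd hw h

/-- Nothing is stripped here: τ(c) = a, so the image begins with the single letter a, which is the
first letter of K_{m+2}. -/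
theorem tau_kernelWord_of_eq {m : ℕ} (h : Letter.next^[m] .a = .c) :
    tau (kernelWord (m + 1)) ++ [.a] = kernelWord (m + 2) := by
  match m with
  | 0 => exact absurd h (by decide)
  | 1 => exact absurd h (by decide)
  | 2 => rfl
  | m + 3 =>
    rw [Function.iterate_add_apply, next_iterate_three, ← word_cen] at h
    rw [kernelWord_add_four, show m + 3 + 2 = m + 1 + 4 by omega, kernelWord_add_four, tau_cons,
      List.append_assoc, ← seg_zero_sig, sig_succ_of_eq h, cen_succ, word_sig_succ, h]
    rfl

theorem kernelWord_ne_nil (m : ℕ) : kernelWord (m + 1) ≠ [] := by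
  intro h
  have := (kernelWord_ends m).1
  simp [h] at this

/-- The number of letters `a` by which `τ(K_{m+1}) a` exceeds `K_{m+2}` on either side. -/
def excess (m : ℕ) : ℕ := if Letter.next^[m] .a = .c then 0 else 1

theorem length_tau_kernelWord (m : ℕ) :
    (tau (kernelWord (m + 1))).length + 1 = (kernelWord (m + 2)).length + 2 * excess m := by
  by_cases h : Letter.next^[m] .a = .c
  · have := congrArg List.length (tau_kernelWord_of_eq h)
    simpa [excess, h] using this
  · have := congrArg List.length (tau_kernelWord_of_ne h)
    simpa [excess, h] using this

theorem occ_kernelWord_succ {m y : ℕ} :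
    Occ (kernelWord (m + 2)) y ↔ ∃ z, Occ (kernelWord (m + 1)) z ∧ y = sig z + excess m := by
  by_cases h : Letter.next^[m] .a = .c
  · rw [← tau_kernelWord_of_eq h, occ_tau]
    simp [excess, h, and_comm]
  · have hn : Letter.next^[m + 1] .a ≠ .a := by
      rw [Function.iterate_succ_apply']
      cases hl : Letter.next^[m] .a <;> simp_all [Letter.next]
    obtain ⟨h1, h2⟩ := kernelWord_ends (m + 1)
    rw [occ_surround h1 hn h2 hn, ← tau_kernelWord_of_ne h]
    simp only [occ_tau, excess, h, if_false]
    constructor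
    · rintro ⟨_, rfl, z, rfl, hz⟩
      exact ⟨z, hz, rfl⟩
    · rintro ⟨z, hz, rfl⟩
      exact ⟨_, rfl, z, rfl, hz⟩

/-! ### Kernels under τ and stripping -/

theorem Occ.infix_iff {w : List Letter} {x : ℕ} (h : Occ w x) {v : List Letter} :
    v <:+: w ↔ ∃ z, x ≤ z ∧ z + v.length ≤ x + w.length ∧ Occ v z := by
  have := infix_seg_iff (v := v) (x := x) (n := w.length)
  rwa [← h] at this

theorem Occ.head?_eq {w : List Letter} {x : ℕ} (h : Occ w x) {d : Letter}
    (hd : w.head? = some d) : word x = d := by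
  obtain ⟨u, rfl⟩ : ∃ u, w = d :: u := by cases w <;> simp_all
  exact (occ_cons.1 h).1

theorem Occ.getLast?_eq {w : List Letter} {x : ℕ} (h : Occ w x) {d : Letter}
    (hd : w.getLast? = some d) : ∃ y, x + w.length = y + 1 ∧ word y = d := by
  obtain ⟨s, rfl⟩ := List.getLast?_eq_some_iff.1 hd
  exact ⟨x + s.length, by simp [Nat.add_assoc], occ_singleton.1 (occ_append.1 h).2⟩

theorem kernelWord_infix_of_tau {w : List Letter} {x m : ℕ} (hw : Occ w x)
    (h : kernelWord (m + 2) <:+: tau w ++ [.a]) : kernelWord (m + 1) <:+: w := by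
  obtain ⟨y, h1, h2, h3⟩ := (occ_tau_sig.2 hw).infix_iff.1 h
  obtain ⟨z, hz, rfl⟩ := occ_kernelWord_succ.1 h3
  have hl := length_tau_kernelWord m
  have hs := sig_add_of_occ hz
  have hs' := sig_add_of_occ hw
  rw [List.length_append, List.length_singleton] at h2
  refine hw.infix_iff.2 ⟨z, ?_, ?_, hz⟩
  -- An occurrence of K_{m+1} starting before w maps too far left: its excess is 1 only if its first
  -- letter has an image of length 2. The right end is symmetric.
  · by_contra hlt
    have h4 := sig_strictMono.monotone (Nat.succ_le_of_lt (not_le.1 hlt))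
    by_cases hc : Letter.next^[m] .a = .c
    · have := sig_strictMono (not_le.1 hlt)
      simp only [excess, hc, if_true] at h1
      omega
    · have h5 := hz.head?_eq (kernelWord_ends m).1
      rw [Nat.succ_eq_add_one, sig_succ_of_ne (by rwa [h5])] at h4
      simp only [excess, hc, if_false] at h1
      omega
  · by_contra hlt
    obtain ⟨y, h5, h6⟩ := hz.getLast?_eq (kernelWord_ends m).2
    rw [h5] at hlt hs
    have h4 := sig_strictMono.monotone (Nat.le_of_lt_succ (not_le.1 hlt))
    by_cases hc : Letter.next^[m] .a = .c
    · have := sig_strictMono (Nat.lt_succ_self y)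
      simp only [Nat.succ_eq_add_one] at this
      simp only [excess, hc, if_true] at h2 hl
      omega
    · rw [sig_succ_of_ne (by rwa [h6])] at hs
      simp only [excess, hc, if_false] at h2 hl
      omega

theorem kernelWord_infix_tau {w : List Letter} {x m : ℕ} (hw : Occ w x) :
    kernelWord (m + 2) <:+: tau w ++ [.a] ↔ kernelWord (m + 1) <:+: w := by
  refine ⟨kernelWord_infix_of_tau hw, fun h => ?_⟩
  have h1 : kernelWord (m + 2) <:+: tau (kernelWord (m + 1)) ++ [.a] := by
    by_cases hc : Letter.next^[m] .a = .c
    · rw [tau_kernelWord_of_eq hc]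
    · rw [tau_kernelWord_of_ne hc]
      exact ⟨[.a], [.a], rfl⟩
  refine h1.trans ?_
  obtain ⟨s, t, rfl⟩ := h
  obtain ⟨u, hu⟩ := tau_append_a_cons t
  refine ⟨tau s, u, ?_⟩
  rw [tau_append, tau_append, List.append_assoc _ (tau t), hu]
  simp

theorem getLast?_eq_head?_of_palindrome {w : List Letter} (h : w.reverse = w) :
    w.getLast? = w.head? := by
  rw [← List.head?_reverse, h]

/-- Stripping could only destroy a K_{m+2} of excess 0. Then K_{m+1} begins and ends with c while w
does not, so it lies strictly inside w. -/
theorem kernelWord_infix_strip {v w : List Letter} {x m : ℕ} (hw : Occ w x)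
    (hv : .a :: v ++ [.a] = tau w ++ [.a]) (hp : w.reverse = w) (hc : word x ≠ .c) :
    kernelWord (m + 2) <:+: v ↔ kernelWord (m + 1) <:+: w := by
  constructor
  · intro h
    refine kernelWord_infix_of_tau hw (h.trans ?_)
    rw [← hv]
    exact ⟨[.a], [.a], rfl⟩
  · intro h
    obtain ⟨z, h1, h2, hz⟩ := hw.infix_iff.1 h
    have hlv := congrArg List.length hv
    simp only [List.length_append, List.length_cons, List.length_nil] at hlv
    have hw' := occ_tau_sig.2 hw
    rw [← hv, List.cons_append, occ_cons, occ_append] at hw'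
    refine hw'.2.1.infix_iff.2
      ⟨sig z + excess m, ?_, ?_, occ_kernelWord_succ.2 ⟨z, hz, rfl⟩⟩
    · by_cases hm : Letter.next^[m] .a = .c
      · have h5 := hz.head?_eq (kernelWord_ends m).1
        have : x ≠ z := by rintro rfl; exact hc (h5.trans hm)
        exact (sig_strictMono (lt_of_le_of_ne h1 this)).trans_le (Nat.le_add_right _ _)
      · have := sig_strictMono.monotone h1
        simp only [excess, hm, if_false]
        omega
    · have hl := length_tau_kernelWord m
      have hs := sig_add_of_occ hz
      have hs' := sig_add_of_occ hw
      by_cases hm : Letter.next^[m] .a = .c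
      · obtain ⟨y, h5, h6⟩ := hz.getLast?_eq (kernelWord_ends m).2
        have hne : w ≠ [] := by
          rintro rfl
          exact kernelWord_ne_nil m (List.infix_nil.1 h)
        obtain ⟨d, hd⟩ : ∃ d, w.head? = some d := by
          cases w <;> simp_all
        have h7 := hw.head?_eq hd
        obtain ⟨y', h8, h9⟩ :=
          hw.getLast?_eq ((getLast?_eq_head?_of_palindrome hp).trans hd)
        have : y ≠ y' := by
          rintro rfl
          exact hc (h7.trans (h9.symm.trans (h6.trans hm)))
        have := sig_strictMono
          (show z + (kernelWord (m + 1)).length < x + w.length by omega)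
        simp only [excess, hm, if_true] at hl ⊢
        omega
      · have := sig_strictMono.monotone h2
        simp only [excess, hm, if_false] at hl ⊢
        omega

/-- Order 1 in v is not governed by the hypothesis, but it never exceeds m + 2. -/
theorem hasKernel_succ_iff {v w : List Letter}
    (h : ∀ m, kernelWord (m + 2) <:+: v ↔ kernelWord (m + 1) <:+: w) (m : ℕ) :
    HasKernel v (m + 2) ↔ HasKernel w (m + 1) := by
  constructor
  · rintro ⟨⟨-, h1⟩, h2⟩
    refine ⟨⟨by omega, (h m).1 h1⟩, ?_⟩
    rintro j ⟨hj, hj'⟩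
    obtain ⟨j, rfl⟩ := Nat.exists_eq_add_of_le' hj
    have := h2 ⟨by omega, (h j).2 hj'⟩
    omega
  · rintro ⟨⟨-, h1⟩, h2⟩
    refine ⟨⟨by omega, (h m).2 h1⟩, ?_⟩
    rintro j ⟨hj, hj'⟩
    match j, hj with
    | 1, _ => omega
    | j + 2, _ =>
      have := h2 ⟨by omega, (h j).1 hj'⟩
      omega

/-! ### Desubstitution of palindromes -/

theorem mem_palindromes_iff {w : List Letter} :
    w ∈ palindromes ↔ w.reverse = w ∧ ∃ z, Occ w z := by
  refine and_congr_right fun _ => ?_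
  constructor
  · rintro ⟨L, h⟩
    obtain ⟨z, hz, -⟩ := occursAt_iff.1 h
    exact ⟨z, hz⟩
  · rintro ⟨z, hz⟩
    exact ⟨z + 1, occursAt_iff.2 ⟨z, hz, rfl⟩⟩

theorem exists_eq_tau_append_a {u : List Letter} {y : ℕ} (hu : Occ u y)
    (h1 : u.head? = some .a) (h2 : u.getLast? = some .a) :
    ∃ w x, Occ w x ∧ u = tau w ++ [.a] := by
  obtain ⟨x, rfl⟩ := word_eq_a_iff.1 (hu.head?_eq h1)
  obtain ⟨s, rfl⟩ := List.getLast?_eq_some_iff.1 h2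
  have h := occ_append.1 hu
  obtain ⟨x', hx'⟩ := word_eq_a_iff.1 (occ_singleton.1 h.2)
  have hle : x ≤ x' := sig_strictMono.le_iff_le.1 (by omega)
  refine ⟨seg x (x' - x), x, occ_seg _ _, ?_⟩
  rw [tau_seg, Nat.add_sub_cancel' hle, ← hx', Nat.add_sub_cancel_left]
  exact congrArg (· ++ _) h.1

theorem strip_palindrome {v w : List Letter} (hv : .a :: v ++ [.a] = tau w ++ [.a]) :
    v.reverse = v ↔ w.reverse = w := by
  rw [← tau_append_a_palindrome (w := w), ← hv]
  simp

theorem tau_seg_append_a (x n : ℕ) :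
    tau (seg x n) ++ [.a] = seg (sig x) (sig (x + n) - sig x + 1) := by
  rw [seg_succ, Nat.add_sub_cancel' (sig_strictMono.monotone (Nat.le_add_right x n)), word_sig,
    tau_seg]

theorem sig_add_two_le {x n : ℕ} (hn : 0 < n) (hc : word x ≠ .c) : sig x + 2 ≤ sig (x + n) := by
  rw [← sig_succ_of_ne hc]
  exact sig_strictMono.monotone (by omega)

theorem tau_seg_strip {x n : ℕ} (hn : 0 < n) (hc : word x ≠ .c) :
    .a :: seg (sig x + 1) (sig (x + n) - (sig x + 1)) ++ [.a] = tau (seg x n) ++ [.a] := by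
  have := sig_add_two_le hn hc
  rw [tau_seg, show sig (x + n) - sig x = sig (x + n) - (sig x + 1) + 1 by omega, seg_cons,
    word_sig]

/-- Every palindrome is `τ(w) a` for a palindrome `w`, or this word without its first and last
letter. -/
theorem exists_palindrome_desubstitution {v : List Letter} (hv : v ∈ palindromes) (hne : v ≠ []) :
    ∃ w ∈ palindromes, ∃ x, Occ w x ∧
      (v = tau w ++ [.a] ∨ (.a :: v ++ [.a] = tau w ++ [.a] ∧ word x ≠ .c)) := by
  obtain ⟨hp, y, hy⟩ := mem_palindromes_iff.1 hv
  obtain ⟨d, hd⟩ : ∃ d, v.head? = some d := by cases v <;> simp_all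
  have hl := (getLast?_eq_head?_of_palindrome hp).trans hd
  by_cases hda : d = .a
  · subst hda
    obtain ⟨w, x, hw, rfl⟩ := exists_eq_tau_append_a hy hd hl
    exact ⟨w, mem_palindromes_iff.2 ⟨tau_append_a_palindrome.1 hp, x, hw⟩, x, hw, Or.inl rfl⟩
  · obtain ⟨z, rfl, hz⟩ := (occ_surround hd hda hl hda).1 hy
    obtain ⟨w, x, hw, h⟩ := exists_eq_tau_append_a hz rfl (by rw [List.getLast?_concat])
    refine ⟨w, mem_palindromes_iff.2 ⟨(strip_palindrome h).1 hp, x, hw⟩, x, hw, Or.inr ⟨h, ?_⟩⟩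
    intro hc
    have h1 := occ_tau_sig.2 hw
    rw [← h, List.cons_append, occ_cons, occ_append] at h1
    have h2 := h1.2.1.head?_eq hd
    rw [word_sig_succ, hc] at h2
    exact hda h2.symm

/-! ### Palindromes with a given kernel -/

/-- The palindrome with kernel `K_{m+1}` whose first occurrence begins at the position `x`. -/
def pal (m x : ℕ) : List Letter := seg x (cen (m + 1) - 2 * x)

/-- The words `pal m x`, for `x < len m`, are the palindromes with the kernel `K_{m+1}`, and
`pal m x` occurs exactly at the positions `sig^(m+1)(n) + x`. -/
structure PalSpec (m : ℕ) : Prop where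
  lt_cen : ∀ x < len m, 2 * x < cen (m + 1)
  mem_iff : ∀ w, (w ∈ palindromes ∧ HasKernel w (m + 1)) ↔ ∃ x < len m, w = pal m x
  occ_iff : ∀ x < len m, ∀ y, Occ (pal m x) y ↔ ∃ n, y = sig^[m + 1] n + x

/-- Every image of a letter begins with a; applying τ^m to that a gives an occurrence of `T m`. -/
theorem occ_seg_len_iterate_sig (m n : ℕ) : Occ (seg 0 (len m)) (sig^[m + 1] n) := by
  induction m with
  | zero => simp [len_zero, seg_one, word_zero, occ_singleton, word_sig]
  | succ m ih =>
    rw [len_succ, Function.iterate_succ_apply' sig (m + 1)]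
    exact ih.seg_sig.seg_of_le (Nat.le_succ _)

theorem palSpec_zero : PalSpec 0 := by
  have hp : pal 0 0 = [.a] := by rw [pal, cen_one]; exact seg_zero_one
  refine ⟨?_, ?_, ?_⟩
  · intro x hx
    rw [len_zero] at hx
    rw [cen_one]
    omega
  · intro w
    rw [len_zero]
    constructor
    · rintro ⟨-, ⟨-, h1⟩, h2⟩
      refine ⟨0, Nat.one_pos, ?_⟩
      rw [hp]
      have hb : ¬ [Letter.b] <:+: w := fun h => absurd (h2 (a := 2) ⟨by omega, h⟩) (by omega)
      have hc : ¬ [Letter.c] <:+: w := fun h => absurd (h2 (a := 3) ⟨by omega, h⟩) (by omega)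
      -- The word aa is K_4.
      have haa : ¬ [Letter.a, Letter.a] <:+: w :=
        fun h => absurd (h2 (a := 4) ⟨by omega, h⟩) (by omega)
      match w with
      | [] => exact absurd (List.infix_nil.1 h1) (kernelWord_ne_nil 0)
      | .b :: t => exact absurd ⟨[], t, rfl⟩ hb
      | .c :: t => exact absurd ⟨[], t, rfl⟩ hc
      | [.a] => rfl
      | .a :: .a :: t => exact absurd ⟨[], t, rfl⟩ haa
      | .a :: .b :: t => exact absurd ⟨[.a], t, rfl⟩ hb
      | .a :: .c :: t => exact absurd ⟨[.a], t, rfl⟩ hc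
    · rintro ⟨x, hx, rfl⟩
      obtain rfl : x = 0 := by omega
      rw [hp]
      refine ⟨mem_palindromes_iff.2 ⟨rfl, 0, occ_singleton.2 word_zero⟩,
        ⟨le_rfl, List.infix_refl _⟩, ?_⟩
      rintro j ⟨hj, hj'⟩
      match j, hj with
      | 1, _ => exact le_rfl
      | j + 2, _ =>
        have := (kernelWord_infix_tau (w := []) (x := 0) (occ_nil 0)).1 hj'
        exact absurd (List.infix_nil.1 this) (kernelWord_ne_nil j)
  · intro x hx y
    rw [len_zero] at hx
    obtain rfl : x = 0 := by omega
    rw [hp, occ_singleton, word_eq_a_iff]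
    rfl

/-- In the palindromic prefix of length `cen (m + 1)`, the last x letters are the reversal of the
first x, so their images have equal length. Hence τ keeps the trimming symmetric. -/
theorem PalSpec.sig_cen {m : ℕ} (h : PalSpec m) {x : ℕ} (hx : x < len m) :
    sig (x + (cen (m + 1) - 2 * x)) + sig x = sig (cen (m + 1)) := by
  have h0 := (mem_palindromes_iff.1 ((h.mem_iff (pal m 0)).2 ⟨0, len_pos m, rfl⟩).1).1
  have hlt := h.lt_cen x hx
  obtain ⟨n, hn⟩ := Nat.exists_eq_add_of_le hlt.le
  rw [pal, show cen (m + 1) - 2 * 0 = x + n + x by omega, seg_add, seg_add, List.reverse_append,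
    List.append_assoc] at h0
  have h1 := (List.append_inj h0 (by simp)).1
  rw [Nat.zero_add] at h1
  have h2 := congrArg List.length (reverse_tau_append_a (seg (x + n) x))
  rw [h1, List.length_reverse, List.length_append, List.length_append, Nat.add_right_cancel_iff]
    at h2
  rw [hn, Nat.add_sub_cancel_left, show 2 * x + n = x + n + x by omega, sig_add (x + n), h2]
  rfl

theorem PalSpec.tau_pal {m : ℕ} (h : PalSpec m) {x : ℕ} (hx : x < len m) :
    tau (pal m x) ++ [.a] = pal (m + 1) (sig x) := by
  have h1 := h.sig_cen hx
  have := sig_strictMono.monotone (Nat.le_add_right x (cen (m + 1) - 2 * x))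
  rw [pal, tau_seg_append_a, pal, cen_succ (m + 1)]
  congr 1
  omega

theorem PalSpec.strip_pal {m : ℕ} (h : PalSpec m) {x : ℕ} (hx : x < len m) (hc : word x ≠ .c) :
    .a :: pal (m + 1) (sig x + 1) ++ [.a] = tau (pal m x) ++ [.a] := by
  have h1 := h.sig_cen hx
  have h2 := h.lt_cen x hx
  have := sig_add_two_le (x := x) (n := cen (m + 1) - 2 * x) (by omega) hc
  have h3 := tau_seg_strip (x := x) (n := cen (m + 1) - 2 * x) (by omega) hc
  rw [pal, pal, cen_succ (m + 1), ← h3, show sig (cen (m + 1)) + 1 - 2 * (sig x + 1) =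
    sig (x + (cen (m + 1) - 2 * x)) - (sig x + 1) by omega]

theorem PalSpec.succ {m : ℕ} (h : PalSpec m) : PalSpec (m + 1) := by
  have hocc : ∀ x, Occ (pal m x) x := fun x => occ_seg _ _
  -- Each new offset is the start of an image, obtained from τ(w)a, or its second letter, obtained
  -- by stripping.
  have key : ∀ x' < len (m + 1), ∃ x < len m,
      (x' = sig x ∨ (x' = sig x + 1 ∧ word x ≠ .c)) := by
    intro x' hx'
    rw [len_succ] at hx'
    obtain ⟨x, hx⟩ := exists_sig x'
    exact ⟨x, sig_strictMono.lt_iff_lt.1 (by omega), hx⟩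
  have hlen : ∀ x < len m, word x ≠ .c → sig x + 2 ≤ len (m + 1) := by
    intro x hx hc
    rw [← sig_succ_of_ne hc, len_succ]
    exact sig_strictMono.monotone hx
  have hlen' : ∀ x < len m, sig x < len (m + 1) := by
    intro x hx
    rw [len_succ]
    exact sig_strictMono hx
  have hiter : ∀ x < len m, ∀ n, sig (sig^[m + 1] n + x) = sig^[m + 2] n + sig x := by
    intro x hx n
    rw [((occ_seg_len_iterate_sig m n).seg_of_le hx.le).sig_add,
      Function.iterate_succ_apply' sig (m + 1)]
  refine ⟨?_, ?_, ?_⟩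
  · intro x' hx'
    obtain ⟨x, hx, h1⟩ := key x' hx'
    have h2 := h.sig_cen hx
    have h3 := h.lt_cen x hx
    rw [cen_succ (m + 1)]
    obtain rfl | ⟨rfl, hc⟩ := h1
    · have := sig_strictMono.monotone (Nat.le_add_right x (cen (m + 1) - 2 * x))
      omega
    · have := sig_add_two_le (x := x) (n := cen (m + 1) - 2 * x) (by omega) hc
      omega
  · intro w'
    constructor
    · rintro ⟨hp, hk⟩
      have hne : w' ≠ [] := by
        rintro rfl
        exact kernelWord_ne_nil (m + 1) (List.infix_nil.1 hk.1.2)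
      obtain ⟨w, hw, x₁, hx₁, rfl | ⟨h1, hc⟩⟩ := exists_palindrome_desubstitution hp hne
      · rw [hasKernel_succ_iff fun _ => kernelWord_infix_tau hx₁] at hk
        obtain ⟨x, hx, rfl⟩ := (h.mem_iff w).1 ⟨hw, hk⟩
        exact ⟨sig x, hlen' x hx, h.tau_pal hx⟩
      · rw [hasKernel_succ_iff fun _ =>
          kernelWord_infix_strip hx₁ h1 (mem_palindromes_iff.1 hw).1 hc] at hk
        obtain ⟨x, hx, rfl⟩ := (h.mem_iff w).1 ⟨hw, hk⟩
        have hd : (pal m x).head? = some (word x) := by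
          obtain ⟨k, hk⟩ := Nat.exists_eq_add_of_lt (h.lt_cen x hx)
          rw [pal, show cen (m + 1) - 2 * x = k + 1 by omega, seg_cons]; rfl
        rw [hx₁.head?_eq hd] at hc
        rw [← h.strip_pal hx hc] at h1
        refine ⟨sig x + 1, hlen x hx hc, ?_⟩
        simpa using h1
    · rintro ⟨x', hx', rfl⟩
      obtain ⟨x, hx, rfl | ⟨rfl, hc⟩⟩ := key x' hx'
      · have hw := (h.mem_iff _).2 ⟨x, hx, rfl⟩
        have hp := (mem_palindromes_iff.1 hw.1).1
        rw [← h.tau_pal hx]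
        exact ⟨mem_palindromes_iff.2
          ⟨tau_append_a_palindrome.2 hp, sig x, occ_tau_sig.2 (hocc x)⟩,
          (hasKernel_succ_iff (fun _ => kernelWord_infix_tau (hocc x)) m).2 hw.2⟩
      · have hw := (h.mem_iff _).2 ⟨x, hx, rfl⟩
        have hp := (mem_palindromes_iff.1 hw.1).1
        have hs := h.strip_pal hx hc
        exact ⟨mem_palindromes_iff.2 ⟨(strip_palindrome hs).2 hp, sig x + 1, occ_seg _ _⟩,
          (hasKernel_succ_iff (fun _ => kernelWord_infix_strip (hocc x) hs hp hc) m).2 hw.2⟩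
  · intro x' hx' y
    obtain ⟨x, hx, rfl | ⟨rfl, hc⟩⟩ := key x' hx'
    · rw [← h.tau_pal hx, occ_tau]
      constructor
      · rintro ⟨z, rfl, hz⟩
        obtain ⟨n, rfl⟩ := (h.occ_iff x hx z).1 hz
        exact ⟨n, hiter x hx n⟩
      · rintro ⟨n, rfl⟩
        exact ⟨_, (hiter x hx n).symm, (h.occ_iff x hx _).2 ⟨n, rfl⟩⟩
    · have hs := h.strip_pal hx hc
      have hp := (mem_palindromes_iff.1 ((h.mem_iff _).2 ⟨x, hx, rfl⟩).1).1
      have h1 := h.sig_cen hx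
      have h2 := h.lt_cen x hx
      have h3 := sig_add_two_le (x := x) (n := cen (m + 1) - 2 * x) (by omega) hc
      have hd : (pal (m + 1) (sig x + 1)).head? = some (word (sig x + 1)) := by
        have h4 := cen_succ (m + 1)
        obtain ⟨k, hk⟩ := Nat.exists_eq_add_of_lt
          (show 2 * (sig x + 1) < cen (m + 1 + 1) by omega)
        rw [pal, show cen (m + 1 + 1) - 2 * (sig x + 1) = k + 1 by omega, seg_cons]; rfl
      have hl := (getLast?_eq_head?_of_palindrome ((strip_palindrome hs).2 hp)).trans hd
      rw [occ_surround hd (word_sig_succ_ne hc) hl (word_sig_succ_ne hc), hs]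
      constructor
      · rintro ⟨_, rfl, hz⟩
        obtain ⟨z, rfl, hz'⟩ := occ_tau.1 hz
        obtain ⟨n, rfl⟩ := (h.occ_iff x hx z).1 hz'
        exact ⟨n, by rw [hiter x hx n, Nat.add_assoc]⟩
      · rintro ⟨n, rfl⟩
        refine ⟨sig^[m + 2] n + sig x, rfl, ?_⟩
        rw [← hiter x hx n, occ_tau_sig]
        exact (h.occ_iff x hx _).2 ⟨n, rfl⟩

theorem palSpec (m : ℕ) : PalSpec m := by
  induction m with
  | zero => exact palSpec_zero
  | succ m ih => exact ih.succ

/-! ### End positions as intervals, and the decomposition -/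

theorem nth_eq_of_strictMono {P : ℕ → Prop} {f : ℕ → ℕ} (hf : StrictMono f)
    (h : ∀ y, P y ↔ ∃ n, y = f n) : Nat.nth P = f := by
  have hr : Set.ofPred P = Set.range f := by
    ext y
    simp only [Set.mem_range, eq_comm (b := y)]
    exact h y
  have hi : (Set.ofPred P).Infinite := hr ▸ Set.infinite_range_of_injective hf.injective
  exact ((Nat.nth_strictMono hi).range_inj hf).1 ((Nat.range_nth_of_infinite hi).trans hr)

theorem lastPos_pal {m x : ℕ} (hx : x < len m) (p : ℕ) :
    lastPos (pal m x) p = sig^[m + 1] (p - 1) + (cen (m + 1) - x) := by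
  have h1 : StrictMono fun n => sig^[m + 1] n + x + 1 := fun a b hab => by
    have := sig_strictMono.iterate (m + 1) hab
    simpa using this
  have h2 := nth_eq_of_strictMono (P := OccursAt (pal m x)) h1 fun y => by
    simp only [occursAt_iff, (palSpec m).occ_iff x hx]
    constructor
    · rintro ⟨_, ⟨n, rfl⟩, rfl⟩
      exact ⟨n, rfl⟩
    · rintro ⟨n, rfl⟩
      exact ⟨_, ⟨n, rfl⟩, rfl⟩
  have h3 := (palSpec m).lt_cen x hx
  rw [lastPos, firstPos, h2, pal, seg_length]
  dsimp only
  omega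

/-- The end position decreases by one as x increases by one, and x takes `len m = cen (m + 1) - cen
m` values. -/
theorem bracket_eq_Ioc (m p : ℕ) :
    bracket (m + 1) p = Set.Ioc (sig^[m + 1] (p - 1) + cen m)
      (sig^[m + 1] (p - 1) + cen (m + 1)) := by
  have hc := cen_succ_eq_len_add m
  ext n
  constructor
  · rintro ⟨w, hw, hk, rfl⟩
    obtain ⟨x, hx, rfl⟩ := ((palSpec m).mem_iff w).1 ⟨hw, hk⟩
    rw [lastPos_pal hx, Set.mem_Ioc]
    omega
  · rintro ⟨h1, h2⟩
    have hx : sig^[m + 1] (p - 1) + cen (m + 1) - n < len m := by omega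
    obtain ⟨hw, hk⟩ := ((palSpec m).mem_iff _).2 ⟨_, hx, rfl⟩
    refine ⟨_, hw, hk, ?_⟩
    rw [lastPos_pal hx]
    omega

theorem lastPos_a (p : ℕ) : lastPos [.a] p = sig (p - 1) + len 0 := by
  have h := lastPos_pal (m := 0) (x := 0) (len_pos 0) p
  rw [pal, cen_one] at h
  rw [← seg_zero_one]
  exact h

theorem cen_two : cen 2 = 3 := by rw [cen_succ, cen_one, sig_one]

/-- The letter b is the centre of the prefix aba, hence `pal 1 1`; likewise c, the centre of
abacaba, is `pal 2 3`. -/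
theorem lastPos_b (p : ℕ) : lastPos [.b] p = sig^[2] (p - 1) + len 1 := by
  have h := lastPos_pal (m := 1) (x := 1) (by rw [len_one]; omega) p
  rwa [pal, cen_two, seg_one, show word 1 = .b from rfl, show 3 - 1 = len 1 from len_one.symm] at h

theorem lastPos_c (p : ℕ) : lastPos [.c] p = sig^[3] (p - 1) + len 2 := by
  have h3 : cen 3 = 7 := by rw [cen_succ_eq_len_add, cen_two, len_two]
  have h := lastPos_pal (m := 2) (x := 3) (by rw [len_two]; omega) p
  rwa [pal, h3, seg_one, show word 3 = .c from rfl, show 7 - 3 = len 2 from len_two.symm] at h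

theorem iterate_sig_add_len (i j n : ℕ) :
    sig^[j] (sig^[i + 1] n + len i) = sig^[j + (i + 1)] n + len (j + i) := by
  rw [(occ_seg_len_iterate_sig i n).iterate_sig_add, Function.iterate_add_apply sig j (i + 1),
    len, len, Function.iterate_add_apply sig j i]

theorem bracket_add_four (k p : ℕ) :
    bracket (k + 4) p =
        bracket (k + 1) (lastPos [.c] p + 1) ∪ bracket (k + 2) (lastPos [.b] p + 1) ∪
          bracket (k + 3) (lastPos [.a] p + 1) ∧
      Disjoint (bracket (k + 1) (lastPos [.c] p + 1)) (bracket (k + 2) (lastPos [.b] p + 1)) ∧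
      Disjoint (bracket (k + 1) (lastPos [.c] p + 1)) (bracket (k + 3) (lastPos [.a] p + 1)) ∧
      Disjoint (bracket (k + 2) (lastPos [.b] p + 1)) (bracket (k + 3) (lastPos [.a] p + 1)) := by
  have ha : sig^[k + 3] (lastPos [.a] p) = sig^[k + 4] (p - 1) + len (k + 3) := by
    rw [lastPos_a]; exact iterate_sig_add_len 0 (k + 3) (p - 1)
  have hb : sig^[k + 2] (lastPos [.b] p) = sig^[k + 4] (p - 1) + len (k + 3) := by
    rw [lastPos_b]; exact iterate_sig_add_len 1 (k + 2) (p - 1)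
  have hc : sig^[k + 1] (lastPos [.c] p) = sig^[k + 4] (p - 1) + len (k + 3) := by
    rw [lastPos_c]; exact iterate_sig_add_len 2 (k + 1) (p - 1)
  have c0 := cen_succ_eq_len_add k
  have c1 : cen (k + 2) = len (k + 1) + cen (k + 1) := cen_succ_eq_len_add (k + 1)
  have c2 : cen (k + 3) = len (k + 2) + cen (k + 2) := cen_succ_eq_len_add (k + 2)
  have c3 : cen (k + 4) = len (k + 3) + cen (k + 3) := cen_succ_eq_len_add (k + 3)
  have hl := len_add_three k
  rw [bracket_eq_Ioc k, bracket_eq_Ioc (k + 1), bracket_eq_Ioc (k + 2), bracket_eq_Ioc (k + 3)]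
  simp only [Nat.add_assoc, Nat.reduceAdd, Nat.add_sub_cancel, ha, hb, hc]
  refine ⟨?_, ?_, ?_, ?_⟩
  -- The outer endpoints agree because cen (k+3) = len (k+3) + cen k.
  · ext n
    simp only [Set.mem_union, Set.mem_Ioc]
    omega
  all_goals
    refine Set.disjoint_left.2 fun n h1 h2 => ?_
    rw [Set.mem_Ioc] at h1 h2
    omega

end Tribonacci

theorem mainTheorem10 (m p : ℕ) (hm : 4 ≤ m) (hp : 1 ≤ p) :
    Tribonacci.bracket m p =
        Tribonacci.bracket (m - 3) (Tribonacci.lastPos [Tribonacci.Letter.c] p + 1) ∪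
        Tribonacci.bracket (m - 2) (Tribonacci.lastPos [Tribonacci.Letter.b] p + 1) ∪
        Tribonacci.bracket (m - 1) (Tribonacci.lastPos [Tribonacci.Letter.a] p + 1) ∧
      Disjoint
        (Tribonacci.bracket (m - 3) (Tribonacci.lastPos [Tribonacci.Letter.c] p + 1))
        (Tribonacci.bracket (m - 2) (Tribonacci.lastPos [Tribonacci.Letter.b] p + 1)) ∧
      Disjoint
        (Tribonacci.bracket (m - 3) (Tribonacci.lastPos [Tribonacci.Letter.c] p + 1))
        (Tribonacci.bracket (m - 1) (Tribonacci.lastPos [Tribonacci.Letter.a] p + 1)) ∧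
      Disjoint
        (Tribonacci.bracket (m - 2) (Tribonacci.lastPos [Tribonacci.Letter.b] p + 1))
        (Tribonacci.bracket (m - 1) (Tribonacci.lastPos [Tribonacci.Letter.a] p + 1)) := by
  obtain ⟨k, rfl⟩ := Nat.exists_eq_add_of_le' hm
  exact Tribonacci.bracket_add_four k p
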